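/- Let $G=\mathrm{PSL}(2,\mathbb C)$ and let $P\subset G$ be the image of the upper triangular matrices with $1$ on the diagonal. Fix a branch $\mathrm{Log}$ of the logarithm on $\mathbb C\setminus\{0\}$. A euclidean horosphere is a horosphere in $\mathbb H^3$ together with an orientation preserving isometry to $\mathbb C$, up to translations; $G$ acts transitively on these, and $H(\infty)$ denotes the plane at height $1$ in upper half space with its projection to $\mathbb C$. A decorated ideal simplex $\Delta$ is an ideal $3$-simplex in $\overline{\mathbb H}{}^3$ with ordered, distinct vertices $v_0,\dots,v_3\in\mathbb C\cup\{\infty\}$ and a euclidean horosphere $H_i$ based at each $v_i$. There are unique $g^{ij}\in G$ ($i\ne j$) such that $g^{ij}$ takes $H(\infty)$ to $H_i$ and $g_{ij}=(g^{ij})^{-1}g^{ji}$ is of the form $\pm\begin{pmatrix}0&-c^{-1}\\ c&0\end{pmatrix}$. The number $c^2$ depends only on the unordered pair $\{i,j\}$ and on the congruence class (under $G$) of the decorated simplex; put $c_{ij}=\exp(\tfrac12\mathrm{Log}(c^2))$. The labeling $\{g^{ij}\}$, up to left multiplication by $G$, is the generator $\bar\Delta$ of the complex $\bar B_*(G,P)$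 of labeled truncated simplices, which computes $H_*(G,P)$. Define $$w_0=\mathrm{Log}\,c_{03}+\mathrm{Log}\,c_{12}-\mathrm{Log}\,c_{02}-\mathrm{Log}\,c_{13},$$ $$w_1=\mathrm{Log}\,c_{02}+\mathrm{Log}\,c_{13}-\mathrm{Log}\,c_{01}-\mathrm{Log}\,c_{23},$$ $$w_2=\mathrm{Log}\,c_{01}+\mathrm{Log}\,c_{23}-\mathrm{Log}\,c_{03}-\mathrm{Log}\,c_{12},$$ and $\Psi(\bar\Delta)=(w_0,w_1,w_2)$. In $\Delta$, the log-parameter $w_0$ is attached to the edges $01,23$, the log-parameter $w_1$ to the edges $12,03$, and $w_2$ to the edges $02,13$. Let $K$ be an oriented complex obtained from finitely many decorated ideal simplices $\Delta_s$ by gluing all their faces in pairs by orientation reversing pairings that preserve the vertex orderings and the decorations (up to congruence), and let $\varepsilon_s=\pm1$ indicate whether the orientation of $\Delta_s$ given by its vertex ordering is that of $K$. Suppose that $K$ represents a homology class in $H_3(G,P)$, i.e. that $\sum_s\varepsilon_s\bar\Delta_s$ is a cycle representing this class. **Theorem.** The triples $\Psi(\bar\Delta_s)$ form a semi-strong flattening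 of $K$. That is: 1. For every $s$, the triple $\Psi(\bar\Delta_s)$ is a flattening of $\Delta_s$: if $z=\frac{(v_0-v_3)(v_1-v_2)}{(v_0-v_2)(v_1-v_3)}$ is the cross-ratio of $\Delta_s$, then there are $p,q\in\mathbb Z$ with $$\Psi(\bar\Delta_s)=\bigl(\mathrm{Log}\,z+p\pi i,\ -\mathrm{Log}(1-z)+q\pi i,\ -\mathrm{Log}\,z+\mathrm{Log}(1-z)-p\pi i-q\pi i\bigr).$$ 2. For every one-cell of $K$, the sum of $\varepsilon_s$ times the log-parameter, over all edges of simplices $\Delta_s$ that are identified to this one-cell, is $0$. 3. For every zero-cell of $K$ and every closed normal curve in its star, the total log-parameter along the curve is $0$. Here a closed normal curve in the star of a zero-cell $x$ avoids the one-skeleton and crosses transversely the two-cells incident to $x$; whenever it passes through a simplex $\Delta_s$ near a vertex $v$ that is a copy of $x$, entering and leaving by different faces containing $v$, it passes the common edge of these faces, and the log-parameter of this edge is counted with the sign $\varepsilon_s$ times $+1$ or $-1$ according to whether the edge is passed counterclockwise or clockwise as viewed from $v$, with respect to the orientation of $K$. -/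

import Mathlib

noncomputable section

namespace IdealFlattening

open OnePoint

/-! ### The groups `SL(2,ℂ)`, `G = PSL(2,ℂ)` and the unipotent subgroup `P` -/

abbrev SL2 : Type := Matrix.SpecialLinearGroup (Fin 2) ℂ

/-- The group `G = PSL(2,ℂ)`. -/
abbrev PSL2 : Type := Matrix.ProjectiveSpecialLinearGroup (Fin 2) ℂ

/-- The class in `PSL(2,ℂ)` of a matrix in `SL(2,ℂ)`. -/
def toPSL : SL2 →* PSL2 := QuotientGroup.mk' _

def mkSL2 (a b c d : ℂ) (h : a * d - b * c = 1) : SL2 :=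
  ⟨!![a, b; c, d], by rw [Matrix.det_fin_two_of, h]⟩

theorem SL2_ext {A B : SL2} (h : ∀ i j, A i j = B i j) : A = B := Matrix.SpecialLinearGroup.ext _ _ h

theorem SL2_det (A : SL2) : A 0 0 * A 1 1 - A 0 1 * A 1 0 = 1 := by
  rw [← Matrix.det_fin_two, A.det_coe]

theorem SL2_mul (A B : SL2) (i j : Fin 2) : (A * B) i j = A i 0 * B 0 j + A i 1 * B 1 j := by
  rw [Matrix.SpecialLinearGroup.coe_mul, Matrix.mul_apply, Fin.sum_univ_two]

/-- The matrix `(x) = [1, x; 0, 1]`. -/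
def unip (x : ℂ) : SL2 := mkSL2 1 x 0 1 (by simp)

theorem unip_mul (x y : ℂ) : unip x * unip y = unip (x + y) := by
  apply SL2_ext
  intro i j
  rw [SL2_mul]
  fin_cases i <;> fin_cases j <;> simp [unip, mkSL2, add_comm]

theorem unip_zero : unip 0 = 1 := by
  apply SL2_ext
  intro i j
  fin_cases i <;> fin_cases j <;> simp [unip, mkSL2]

theorem unip_inv (x : ℂ) : (unip x)⁻¹ = unip (-x) := by
  rw [inv_eq_iff_mul_eq_one, unip_mul, add_neg_cancel, unip_zero]

/-- The subgroup `P` of `G`: the image of the upper triangular matrices with `1` on the diagonal. -/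
def P : Subgroup PSL2 where
  carrier := {g | ∃ x : ℂ, g = toPSL (unip x)}
  mul_mem' := by
    rintro _ _ ⟨x, rfl⟩ ⟨y, rfl⟩
    exact ⟨x + y, by rw [← map_mul, unip_mul]⟩
  one_mem' := ⟨0, by rw [unip_zero, map_one]⟩
  inv_mem' := by
    rintro _ ⟨x, rfl⟩
    exact ⟨-x, by rw [← map_inv, unip_inv]⟩

/-- `g ∈ G` is counter diagonal, i.e. of the form `[0, -a⁻¹; a, 0]`. -/
def IsCounterDiagonal (g : PSL2) : Prop :=
  ∃ A : SL2, toPSL A = g ∧ A 0 0 = 0 ∧ A 1 1 = 0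

theorem toPSL_eq_iff (A B : SL2) :
    toPSL A = toPSL B ↔ ∃ r : ℂ, r ^ 2 = 1 ∧ ∀ i j, B i j = r * A i j := by
  unfold toPSL
  rw [QuotientGroup.mk'_eq_mk']
  constructor
  · rintro ⟨z, hz, rfl⟩
    obtain ⟨r, hr, hrz⟩ := Matrix.SpecialLinearGroup.mem_center_iff.mp hz
    refine ⟨r, by simpa using hr, fun i j => ?_⟩
    rw [Matrix.SpecialLinearGroup.coe_mul, ← hrz]
    simp [Matrix.scalar_apply, Matrix.mul_diagonal, mul_comm]
  · rintro ⟨r, hr, h⟩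
    have hz : (Matrix.scalar (Fin 2) r).det = 1 := by
      simpa [Matrix.scalar_apply, Matrix.det_diagonal] using hr
    let Z : SL2 := ⟨Matrix.scalar (Fin 2) r, hz⟩
    refine ⟨Z, Matrix.SpecialLinearGroup.mem_center_iff.mpr ⟨r, by simpa using hr, rfl⟩, ?_⟩
    apply SL2_ext
    intro i j
    have hZ : (Z : Matrix (Fin 2) (Fin 2) ℂ) = Matrix.scalar (Fin 2) r := rfl
    rw [Matrix.SpecialLinearGroup.coe_mul, h, hZ]
    simp [Matrix.scalar_apply, Matrix.mul_diagonal, mul_comm]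

/-- The square `c(g)²` of the lower left entry; it is well defined on `PSL(2,ℂ)`. -/
def cSq (g : PSL2) : ℂ :=
  Quotient.liftOn g (fun A : SL2 => (A 1 0) ^ 2) (by
    intro A B h
    have h' : toPSL A = toPSL B := Quotient.sound h
    obtain ⟨r, hr, hAB⟩ := (toPSL_eq_iff A B).mp h'
    change (A 1 0) ^ 2 = (B 1 0) ^ 2
    rw [hAB, mul_pow, hr, one_mul])

/-! ### Logarithm branches, cross-ratios and flattenings -/

/-- A branch of the logarithm on `ℂ ∖ {0}`; no continuity is required. -/
structure LogBranch where
  toFun : ℂ → ℂ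
  exp_toFun : ∀ z : ℂ, z ≠ 0 → Complex.exp (toFun z) = z

instance : CoeFun LogBranch (fun _ => ℂ → ℂ) := ⟨LogBranch.toFun⟩

/-- Homogeneous coordinates of a point of `ℂ ∪ {∞}`. -/
def homog (v : OnePoint ℂ) : ℂ × ℂ := v.elim (1, 0) (fun z => (z, 1))

/-- The difference `z - w`, homogenized so that it makes sense on `ℂ ∪ {∞}`. -/
def hdiff (v w : OnePoint ℂ) : ℂ :=
  (homog v).1 * (homog w).2 - (homog w).1 * (homog v).2

/-- The cross-ratio `[z₀:z₁:z₂:z₃] = (z₀-z₃)(z₁-z₂) / ((z₀-z₂)(z₁-z₃))` on `ℂ ∪ {∞}`. -/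
def crossRatio (v : Fin 4 → OnePoint ℂ) : ℂ :=
  (hdiff (v 0) (v 3) * hdiff (v 1) (v 2)) / (hdiff (v 0) (v 2) * hdiff (v 1) (v 3))

/-- `w = (w₀, w₁, w₂)` is a flattening of an ideal simplex with cross-ratio `z`. -/
def IsFlattening (L : LogBranch) (z : ℂ) (w : Fin 3 → ℂ) : Prop :=
  ∃ p q : ℤ,
    w 0 = L z + p * (Real.pi * Complex.I) ∧
    w 1 = -L (1 - z) + q * (Real.pi * Complex.I) ∧
    w 2 = -L z + L (1 - z) - p * (Real.pi * Complex.I) - q * (Real.pi * Complex.I)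

/-- The log-parameter (or cross-ratio parameter) of the edge joining the vertices `i ≠ j`:
`w₀` on the edges `01, 23`, `w₁` on the edges `12, 03`, and `w₂` on the edges `02, 13`. -/
def edgeParam (w : Fin 3 → ℂ) (i j : Fin 4) : ℂ :=
  if ({i, j} : Finset (Fin 4)) = {0, 1} ∨ ({i, j} : Finset (Fin 4)) = {2, 3} then w 0
  else if ({i, j} : Finset (Fin 4)) = {1, 2} ∨ ({i, j} : Finset (Fin 4)) = {0, 3} then w 1
  else w 2

/-! ### The complex of truncated simplices -/

/-- A generator of `C̄ₙ(G,P)`: a labeling `g^{ij}` of the vertices `ij` (`i ≠ j`) of a truncated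
`n`-simplex by elements of `G` such that, for fixed `i`, the `g^{ij}` are distinct elements of one
left `P`-coset, and every `g_{ij} = (g^{ij})⁻¹ g^{ji}` is counter diagonal. -/
structure TruncLabeling (n : ℕ) where
  label : ∀ i j : Fin (n + 1), i ≠ j → PSL2
  distinct : ∀ i j k (hj : i ≠ j) (hk : i ≠ k), j ≠ k → label i j hj ≠ label i k hk
  coset : ∀ i j k (hj : i ≠ j) (hk : i ≠ k), (label i j hj)⁻¹ * label i k hk ∈ P
  counter : ∀ i j (h : i ≠ j), IsCounterDiagonal ((label i j h)⁻¹ * label j i h.symm)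

/-- The label `g_{ij}` of a long edge. -/
def TruncLabeling.long {n : ℕ} (a : TruncLabeling n) (i j : Fin (n + 1)) (h : i ≠ j) : PSL2 :=
  (a.label i j h)⁻¹ * a.label j i h.symm

/-- The face opposite to the vertex `k`. -/
def TruncLabeling.face {n : ℕ} (a : TruncLabeling (n + 1)) (k : Fin (n + 2)) : TruncLabeling n where
  label i j h := a.label (k.succAbove i) (k.succAbove j) (Fin.succAbove_right_injective.ne h)
  distinct _ _ _ _ _ h :=
    a.distinct _ _ _ _ _ (Fin.succAbove_right_injective.ne h)
  coset _ _ _ _ _ := a.coset _ _ _ _ _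
  counter _ _ _ := a.counter _ _ _

/-- Two labelings differ by left multiplication by an element of `G`. -/
def truncSetoid (n : ℕ) : Setoid (TruncLabeling n) where
  r a b := ∃ g : PSL2, ∀ i j h, b.label i j h = g * a.label i j h
  iseqv :=
    { refl := fun a => ⟨1, fun i j h => (one_mul _).symm⟩
      symm := by
        rintro a b ⟨g, hg⟩
        exact ⟨g⁻¹, fun i j h => by rw [hg, inv_mul_cancel_left]⟩
      trans := by
        rintro a b c ⟨g, hg⟩ ⟨k, hk⟩
        exact ⟨k * g, fun i j h => by rw [hk, hg, mul_assoc]⟩ }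

/-- The generators of `B̄ₙ(G,P) = C̄ₙ(G,P) ⊗_{ℤ[G]} ℤ`. -/
def BGen (n : ℕ) : Type := Quotient (truncSetoid n)

/-- The class in `B̄ₙ(G,P)` of a generator of `C̄ₙ(G,P)`. -/
def BGen.mk {n : ℕ} (a : TruncLabeling n) : BGen n := Quotient.mk (truncSetoid n) a

def BGen.face {n : ℕ} (a : BGen (n + 1)) (k : Fin (n + 2)) : BGen n :=
  Quotient.map' (s₁ := truncSetoid (n + 1)) (s₂ := truncSetoid n) (fun b => b.face k)
    (by
      rintro b c ⟨g, hg⟩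
      exact ⟨g, fun i j h => hg _ _ _⟩) a

/-- The group `B̄ₙ(G,P)`. -/
abbrev BarB (n : ℕ) : Type := BGen n →₀ ℤ

/-- The boundary map `B̄ₙ₊₁(G,P) → B̄ₙ(G,P)`. -/
def boundary (n : ℕ) : BarB (n + 1) →ₗ[ℤ] BarB n :=
  Finsupp.linearCombination ℤ fun a : BGen (n + 1) =>
    ∑ k : Fin (n + 2), (-1 : ℤ) ^ (k : ℕ) • Finsupp.single (a.face k) (1 : ℤ)

/-- The group `H₃(G,P)`, computed by the complex `B̄_*(G,P)`. -/
abbrev H3 : Type :=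
  LinearMap.ker (boundary 2) ⧸
    (LinearMap.range (boundary 3)).comap (LinearMap.ker (boundary 2)).subtype

/-- `c(g_{ij})² = c(g_{ji})²` for a generator of `B̄ₙ(G,P)`. -/
def BGen.longCSq {n : ℕ} (a : BGen n) (i j : Fin (n + 1)) (h : i ≠ j) : ℂ :=
  Quotient.liftOn (s := truncSetoid n) a (fun b => cSq (b.long i j h)) (by
    rintro b c ⟨g, hg⟩
    simp only [TruncLabeling.long, hg, mul_inv_rev, mul_assoc, inv_mul_cancel_left])

/-- The entry `c(g_{ij})` of the representative of `g_{ij}` in `SL(2,ℂ)` that is singled out by the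
square root `x ↦ exp (Log x / 2)` belonging to the branch of the logarithm. -/
def BGen.longC (L : LogBranch) {n : ℕ} (a : BGen n) (i j : Fin (n + 1)) (h : i ≠ j) : ℂ :=
  Complex.exp (L (a.longCSq i j h) / 2)

/-- The map `Ψ` on generators: the log-parameters `(w₀(α), w₁(α), w₂(α))`. -/
def Psi (L : LogBranch) (a : BGen 3) : Fin 3 → ℂ :=
  ![L (a.longC L 0 3 (by decide)) + L (a.longC L 1 2 (by decide))
      - L (a.longC L 0 2 (by decide)) - L (a.longC L 1 3 (by decide)),
    L (a.longC L 0 2 (by decide)) + L (a.longC L 1 3 (by decide))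
      - L (a.longC L 0 1 (by decide)) - L (a.longC L 2 3 (by decide)),
    L (a.longC L 0 1 (by decide)) + L (a.longC L 2 3 (by decide))
      - L (a.longC L 0 3 (by decide)) - L (a.longC L 1 2 (by decide))]

/-! ### Hyperbolic space and euclidean horospheres -/

/-- The upper half space model of hyperbolic 3-space. -/
@[ext] structure HypSpace where
  z : ℂ
  t : ℝ
  pos : 0 < t

def actDen (A : SL2) (p : HypSpace) : ℝ :=
  Complex.normSq (A 1 0 * p.z + A 1 1) + Complex.normSq (A 1 0) * p.t ^ 2

theorem actDen_pos (A : SL2) (p : HypSpace) : 0 < actDen A p := by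
  unfold actDen
  have hp := p.pos
  by_cases h : A 1 0 = 0
  · have hd : A 1 1 ≠ 0 := by
      intro hd
      have := A.det_coe
      rw [Matrix.det_fin_two] at this
      simp [h, hd] at this
    have := Complex.normSq_pos.mpr hd
    simpa [h] using this
  · have := Complex.normSq_pos.mpr h
    have h2 := Complex.normSq_nonneg (A 1 0 * p.z + A 1 1)
    positivity

/-- `SL(2,ℂ)` acts on upper half space by the Poincaré extension of fractional linear
transformations. -/
instance : SMul SL2 HypSpace where
  smul A p :=
    { z := ((A 0 0 * p.z + A 0 1) * star (A 1 0 * p.z + A 1 1)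
              + A 0 0 * star (A 1 0) * (p.t : ℂ) ^ 2) / (actDen A p : ℂ)
      t := p.t / actDen A p
      pos := div_pos p.pos (actDen_pos A p) }

theorem smul_z (A : SL2) (p : HypSpace) :
    (A • p).z = ((A 0 0 * p.z + A 0 1) * star (A 1 0 * p.z + A 1 1)
      + A 0 0 * star (A 1 0) * (p.t : ℂ) ^ 2) / (actDen A p : ℂ) := rfl

theorem smul_t (A : SL2) (p : HypSpace) : (A • p).t = p.t / actDen A p := rfl


theorem actDen_cast (A : SL2) (p : HypSpace) : (actDen A p : ℂ) =
    (A 1 0 * p.z + A 1 1) * star (A 1 0 * p.z + A 1 1) + A 1 0 * star (A 1 0) * (p.t : ℂ) ^ 2 := by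
  simp only [actDen, Complex.ofReal_add, Complex.ofReal_mul, Complex.ofReal_pow, ← Complex.mul_conj,
    starRingEnd_apply]

theorem actDen_mul (A B : SL2) (p : HypSpace) :
    actDen (A * B) p = actDen A (B • p) * actDen B p := by
  have hD : (actDen B p : ℂ) ≠ 0 := by exact_mod_cast (actDen_pos B p).ne'
  have hDs : star (actDen B p : ℂ) = (actDen B p : ℂ) := Complex.conj_ofReal _
  have hts : star (p.t : ℂ) = (p.t : ℂ) := Complex.conj_ofReal _
  have h1 := SL2_det B
  have h2 : star (B 0 0) * star (B 1 1) - star (B 0 1) * star (B 1 0) = 1 := by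
    simpa using congrArg star h1
  have e := actDen_cast B p
  have : (actDen (A * B) p : ℂ) = actDen A (B • p) * actDen B p := by
    rw [actDen_cast, actDen_cast, smul_z, smul_t]
    simp only [SL2_mul, star_add, star_mul', star_div₀, star_pow, hDs, hts, star_star,
      Complex.ofReal_div] at e ⊢
    field_simp
    generalize (actDen B p : ℂ) = D at *
    subst e
    linear_combination A 1 0 * star (A 1 0) * (p.t : ℂ) ^ 2 *
      ((star (B 0 0) * star (B 1 1) - star (B 0 1) * star (B 1 0)) * h1 + h2)
  exact_mod_cast this

theorem mul_smul' (A B : SL2) (p : HypSpace) : (A * B) • p = A • B • p := by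
  have hD : (actDen B p : ℂ) ≠ 0 := by exact_mod_cast (actDen_pos B p).ne'
  have hE : (actDen A (B • p) : ℂ) ≠ 0 := by exact_mod_cast (actDen_pos A _).ne'
  have hDs : star (actDen B p : ℂ) = (actDen B p : ℂ) := Complex.conj_ofReal _
  have hts : star (p.t : ℂ) = (p.t : ℂ) := Complex.conj_ofReal _
  have h1 := SL2_det B
  have h2 : star (B 0 0) * star (B 1 1) - star (B 0 1) * star (B 1 0) = 1 := by
    simpa using congrArg star h1
  have e := actDen_cast B p
  ext
  · rw [smul_z, smul_z A, actDen_mul, smul_z, smul_t]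
    push_cast
    simp only [SL2_mul, star_add, star_mul', star_div₀, star_pow, hDs, hts, star_star] at e ⊢
    field_simp
    generalize (actDen B p : ℂ) = D at *
    subst e
    linear_combination A 0 0 * star (A 1 0) * (p.t : ℂ) ^ 2 *
      ((star (B 0 0) * star (B 1 1) - star (B 0 1) * star (B 1 0)) * h1 + h2)
  · rw [smul_t, smul_t, smul_t, actDen_mul, div_div, mul_comm]

instance : MulAction SL2 HypSpace where
  one_smul p := by
    have h : actDen 1 p = 1 := by simp [actDen]
    ext
    · rw [smul_z, h]; simp
    · rw [smul_t, h]; simp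
  mul_smul := mul_smul'

/-- The point at height `1` over `z`. -/
def height1 (z : ℂ) : HypSpace := ⟨z, 1, one_pos⟩

/-- `SL(2,ℂ)` acts on the boundary `ℂ ∪ {∞}` by fractional linear transformations. -/
instance : MulAction SL2 (OnePoint ℂ) :=
  MulAction.compHom (OnePoint ℂ) (Matrix.SpecialLinearGroup.toGL (n := Fin 2) (R := ℂ))

/-- The horosphere `A • {height 1}`, based at `A • ∞`, together with the isometry to `ℂ` that
corresponds to the orientation preserving isometry `z ↦ u * z + b` of `ℂ`. It is recorded by the
inverse map `ℂ → ℍ³`; the collection over all `b` is its class modulo translations. -/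
def horoCharts (A : SL2) (u : ℂ) : Set (ℂ → HypSpace) :=
  {ψ | ∃ b : ℂ, ψ = fun z => A • height1 (u * z + b)}

/-- A euclidean horosphere: a horosphere based at a point of `ℂ ∪ {∞}`, with an orientation
preserving isometry to `ℂ` up to translation. Here `charts` is the set of the inverses `ℂ → ℍ³` of
the isometries in the translation class; the horosphere is their common range. -/
@[ext] structure EuclideanHorosphere where
  base : OnePoint ℂ
  charts : Set (ℂ → HypSpace)
  isHorosphere : ∃ (A : SL2) (u : ℂ), ‖u‖ = 1 ∧ A • (∞ : OnePoint ℂ) = base ∧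
    charts = horoCharts A u

theorem image_horoCharts (A B : SL2) (u : ℂ) :
    (fun ψ : ℂ → HypSpace => fun z => A • ψ z) '' horoCharts B u = horoCharts (A * B) u := by
  ext ψ
  constructor
  · rintro ⟨_, ⟨b, rfl⟩, rfl⟩
    exact ⟨b, funext fun z => (mul_smul A B _).symm⟩
  · rintro ⟨b, rfl⟩
    exact ⟨_, ⟨b, rfl⟩, funext fun z => (mul_smul A B _).symm⟩

instance : SMul SL2 EuclideanHorosphere where
  smul A H :=
    { base := A • H.base
      charts := (fun ψ : ℂ → HypSpace => fun z => A • ψ z) '' H.charts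
      isHorosphere := by
        obtain ⟨B, u, hu, hB, hH⟩ := H.isHorosphere
        exact ⟨A * B, u, hu, by rw [mul_smul, hB], by rw [hH, image_horoCharts]⟩ }

theorem smul_base (A : SL2) (H : EuclideanHorosphere) : (A • H).base = A • H.base := rfl

theorem smul_charts (A : SL2) (H : EuclideanHorosphere) :
    (A • H).charts = (fun ψ : ℂ → HypSpace => fun z => A • ψ z) '' H.charts := rfl

instance : MulAction SL2 EuclideanHorosphere where
  one_smul H := by
    ext1
    · rw [smul_base, one_smul]
    · rw [smul_charts]; simp
  mul_smul A B H := by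
    ext1
    · simp only [smul_base, mul_smul]
    · simp only [smul_charts, Set.image_image, mul_smul]

/-- The reference euclidean horosphere `H(∞)`: the plane at height `1`, projected to `ℂ`. -/
def HInf : EuclideanHorosphere where
  base := ∞
  charts := horoCharts 1 1
  isHorosphere := ⟨1, 1, by simp, one_smul _ _, rfl⟩

/-! ### Decorated ideal simplices -/

/-- An ideal `n`-simplex (with ordered, distinct ideal vertices) decorated by a euclidean horosphere
at each vertex. -/
@[ext] structure DecoratedSimplex (n : ℕ) where
  horo : Fin (n + 1) → EuclideanHorosphere
  distinct : Function.Injective fun i => (horo i).base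

/-- The ideal vertices. -/
def DecoratedSimplex.vertex {n : ℕ} (D : DecoratedSimplex n) (i : Fin (n + 1)) : OnePoint ℂ :=
  (D.horo i).base

/-- The decorated face opposite to the vertex `k`. -/
def DecoratedSimplex.face {n : ℕ} (D : DecoratedSimplex (n + 1)) (k : Fin (n + 2)) :
    DecoratedSimplex n where
  horo i := D.horo (k.succAbove i)
  distinct := D.distinct.comp Fin.succAbove_right_injective

/-- Two decorated ideal simplices are congruent if they differ by an element of `G`. -/
def DecoratedSimplex.Congruent {n : ℕ} (D E : DecoratedSimplex n) : Prop :=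
  ∃ A : SL2, ∀ i, E.horo i = A • D.horo i

/-- The labeling `a` corresponds to the decorated ideal simplex `D`: every `g^{ij}` takes `H(∞)` to
the euclidean horosphere at the `i`-th vertex. -/
def TruncLabeling.Represents {n : ℕ} (a : TruncLabeling n) (D : DecoratedSimplex n) : Prop :=
  ∀ i j h, ∃ A : SL2, toPSL A = a.label i j h ∧ A • HInf = D.horo i

theorem smul_infty (A : SL2) :
    A • (∞ : OnePoint ℂ) = if A 1 0 = 0 then ∞ else ((A 0 0 / A 1 0 : ℂ) : OnePoint ℂ) :=
  OnePoint.smul_infty_eq_ite (Matrix.SpecialLinearGroup.toGL A)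

theorem unip_smul_HInf (x : ℂ) : unip x • HInf = HInf := by
  have key : ∀ z, unip x • height1 z = height1 (z + x) := by
    intro z
    have h : actDen (unip x) (height1 z) = 1 := by simp [actDen, unip, mkSL2]
    ext
    · rw [smul_z, h]; simp [unip, mkSL2, height1]
    · rw [smul_t, h]; simp [height1]
  ext1
  · change unip x • (∞ : OnePoint ℂ) = ∞
    rw [smul_infty]
    simp [unip, mkSL2]
  · rw [smul_charts]
    change _ '' horoCharts 1 1 = horoCharts 1 1
    rw [image_horoCharts]
    ext ψ
    constructor
    · rintro ⟨b, rfl⟩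
      exact ⟨b + x, funext fun z => by simp [key, add_assoc]⟩
    · rintro ⟨b, rfl⟩
      exact ⟨b - x, funext fun z => by simp [key, add_assoc]⟩

theorem exists_smul_HInf (H : EuclideanHorosphere) : ∃ A : SL2, A • HInf = H := by
  obtain ⟨B, u, hu, hB, hH⟩ := H.isHorosphere
  obtain ⟨v, hv⟩ : ∃ v : ℂ, v ^ 2 = u := IsAlgClosed.exists_pow_nat_eq u two_pos
  have hu0 : u ≠ 0 := by rintro rfl; simp at hu
  have hn : ‖v‖ = 1 := by
    have h : ‖v‖ ^ 2 = 1 := by rw [← norm_pow, hv, hu]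
    exact (pow_eq_one_iff_of_nonneg (norm_nonneg v) two_ne_zero).mp h
  have hv0 : v ≠ 0 := by rintro rfl; simp at hn
  have hs : star v = v⁻¹ := (Complex.inv_eq_conj hn).symm
  let C : SL2 := mkSL2 v 0 0 v⁻¹ (by simp [hv0])
  have key : ∀ z, C • height1 z = height1 (u * z) := by
    intro z
    have h : actDen C (height1 z) = 1 := by
      simp [actDen, C, mkSL2, Complex.normSq_eq_norm_sq, hn]
    ext
    · rw [smul_z, h]
      simp only [C, mkSL2, height1]
      simp [← hv, hs, star_inv₀]
      ring
    · rw [smul_t, h]; simp [height1]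
  refine ⟨B * C, ?_⟩
  ext1
  · change (B * C) • (∞ : OnePoint ℂ) = H.base
    rw [mul_smul, ← hB, smul_infty C]
    simp [C, mkSL2]
  · rw [smul_charts, hH]
    change _ '' horoCharts 1 1 = horoCharts B u
    rw [image_horoCharts]
    ext ψ
    constructor
    · rintro ⟨b, rfl⟩
      exact ⟨u * b, funext fun z => by simp [mul_smul, key, mul_add]⟩
    · rintro ⟨b, rfl⟩
      exact ⟨u⁻¹ * b, funext fun z => by simp [mul_smul, key, mul_add, hu0]⟩

theorem mul_unip_zero (A : SL2) (x : ℂ) (i : Fin 2) : (A * unip x) i 0 = A i 0 := by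
  rw [SL2_mul]; simp [unip, mkSL2]

theorem mul_unip_one (A : SL2) (x : ℂ) (i : Fin 2) : (A * unip x) i 1 = A i 0 * x + A i 1 := by
  rw [SL2_mul]; simp [unip, mkSL2]

theorem exists_represents {n : ℕ} (D : DecoratedSimplex n) :
    ∃ a : TruncLabeling n, a.Represents D := by
  choose A hA using fun i => exists_smul_HInf (D.horo i)
  have hbase : ∀ i, (D.horo i).base = A i • (∞ : OnePoint ℂ) := fun i => by
    rw [← hA i, smul_base]; rfl
  -- the determinant of the first columns of `A i` and `A j`
  let m : Fin (n + 1) → Fin (n + 1) → ℂ := fun i j => A i 0 0 * A j 1 0 - A i 1 0 * A j 0 0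
  have hm : ∀ i j, i ≠ j → m i j ≠ 0 := by
    intro i j hij h0
    apply hij
    apply D.distinct
    simp only [hbase, smul_infty]
    have hi := SL2_det (A i)
    have hj := SL2_det (A j)
    simp only [m] at h0
    by_cases h1 : A i 1 0 = 0
    · have hi0 : A i 0 0 ≠ 0 := by
        intro h; simp [h, h1] at hi
      have h2 : A j 1 0 = 0 := by simpa [h1, hi0] using h0
      simp [h1, h2]
    · have h2 : A j 1 0 ≠ 0 := by
        intro h2
        have hj0 : A j 0 0 = 0 := by simpa [h1, h2] using h0
        simp [h2, hj0] at hj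
      rw [if_neg h1, if_neg h2]
      congr 1
      field_simp
      linear_combination h0
  let x : Fin (n + 1) → Fin (n + 1) → ℂ := fun i j =>
    (A i 1 1 * A j 0 0 - A i 0 1 * A j 1 0) / m i j
  have hx : ∀ i j, i ≠ j → x i j * m i j = A i 1 1 * A j 0 0 - A i 0 1 * A j 1 0 :=
    fun i j h => div_mul_cancel₀ _ (hm i j h)
  refine ⟨⟨fun i j _ => toPSL (A i * unip (x i j)), ?_, ?_, ?_⟩, fun i j h =>
    ⟨A i * unip (x i j), rfl, by rw [mul_smul, unip_smul_HInf, hA]⟩⟩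
  · intro i j k hj hk hjk h
    have hxx : x i j = x i k := by
      rw [map_mul, map_mul, mul_right_inj, toPSL_eq_iff] at h
      obtain ⟨r, -, hr⟩ := h
      have h00 := hr 0 0
      have h01 := hr 0 1
      simp [unip, mkSL2] at h00 h01
      rw [h01, ← h00, one_mul]
    apply hm j k hjk
    have e1 := hx i j hj
    have e2 := hx i k hk
    rw [← hxx] at e2
    have hi := SL2_det (A i)
    simp only [m] at e1 e2 ⊢
    linear_combination (-(A j 0 0 * A k 1 0 - A j 1 0 * A k 0 0)) * hi
      + (A i 0 0 * A k 1 0 - A i 1 0 * A k 0 0) * (-e1)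
      + (A i 0 0 * A j 1 0 - A i 1 0 * A j 0 0) * e2
  · intro i j k hj hk
    refine ⟨-x i j + x i k, ?_⟩
    rw [← map_inv, ← map_mul, ← unip_mul, ← unip_inv]
    group
  · intro i j h
    refine ⟨(A i * unip (x i j))⁻¹ * (A j * unip (x j i)), by rw [map_mul, map_inv], ?_, ?_⟩
    · have e := hx i j h
      rw [SL2_mul, Matrix.SpecialLinearGroup.SL2_inv_expl]
      simp only [m] at e
      generalize x i j = y at e ⊢
      generalize x j i = y' at e ⊢
      simp [mul_unip_zero, mul_unip_one]
      linear_combination -e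
    · have e := hx j i h.symm
      rw [SL2_mul, Matrix.SpecialLinearGroup.SL2_inv_expl]
      simp only [m] at e
      generalize x i j = y at e ⊢
      generalize x j i = y' at e ⊢
      simp [mul_unip_zero, mul_unip_one]
      linear_combination -e

/-- The generator of `B̄ₙ(G,P)` corresponding to a decorated ideal simplex. -/
def DecoratedSimplex.generator {n : ℕ} (D : DecoratedSimplex n) : BGen n :=
  BGen.mk (exists_represents D).choose

/-! ### Complexes of decorated ideal simplices -/

/-- A complex obtained from finitely many decorated ideal 3-simplices, indexed by `ι`, by gluing all
their faces in pairs. The face of `Δ_s` opposite to its vertex `b` is recorded as `(s, b)`. Face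
pairings preserve the vertex orderings and the decorations. The complex is oriented; `sign s` is `1`
if and only if the orientation of `Δ_s` given by its vertex ordering is the one of the complex, and
face pairings are orientation reversing (in particular no face is glued to itself). -/
structure DecoratedComplex (ι : Type*) where
  simplex : ι → DecoratedSimplex 3
  sign : ι → ℤˣ
  glue : ι × Fin 4 → ι × Fin 4
  glue_glue : ∀ f, glue (glue f) = f
  congruent : ∀ f, DecoratedSimplex.Congruent ((simplex f.1).face f.2)
    ((simplex (glue f).1).face (glue f).2)
  oriented : ∀ f, sign (glue f).1 * (-1) ^ ((glue f).2 : ℕ) = -(sign f.1 * (-1) ^ (f.2 : ℕ))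

namespace DecoratedComplex

variable {ι : Type*}

/-- The chain `∑ εₛ Δ̄ₛ` in `B̄₃(G,P)`. -/
def chain [Fintype ι] (K : DecoratedComplex ι) : BarB 3 :=
  ∑ s, Finsupp.single (K.simplex s).generator ((K.sign s : ℤˣ) : ℤ)

/-- `K` represents the homology class `c`. -/
def RepresentsClass [Fintype ι] (K : DecoratedComplex ι) (c : H3) : Prop :=
  ∃ h : K.chain ∈ LinearMap.ker (boundary 2), c = Submodule.Quotient.mk ⟨K.chain, h⟩

/-- A vertex `v` of a simplex, as an element of `ι × Fin 4`, is identified with another one by a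
face pairing. The pairing matches the `m`-th vertices of the two faces. -/
def vertexRel (K : DecoratedComplex ι) (x y : ι × Fin 4) : Prop :=
  ∃ (f : ι × Fin 4) (m : Fin 3), x = (f.1, f.2.succAbove m) ∧
    y = ((K.glue f).1, (K.glue f).2.succAbove m)

/-- The zero-cells of `K`. -/
def ZeroCell (K : DecoratedComplex ι) : Type _ := Quot K.vertexRel

/-- The edges of the 3-simplex, as increasing pairs of vertices. -/
abbrev SimplexEdge : Type := {e : Fin 4 × Fin 4 // e.1 < e.2}

/-- An edge of a simplex is identified with another one by a face pairing. -/
def edgeRel (K : DecoratedComplex ι) (x y : ι × SimplexEdge) : Prop :=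
  ∃ (f : ι × Fin 4) (m m' : Fin 3),
    x.1 = f.1 ∧ x.2.1 = (f.2.succAbove m, f.2.succAbove m') ∧
    y.1 = (K.glue f).1 ∧ y.2.1 = ((K.glue f).2.succAbove m, (K.glue f).2.succAbove m')

/-- The one-cells of `K`. -/
def OneCell (K : DecoratedComplex ι) : Type _ := Quot K.edgeRel

/-- The sign of a sequence of four vertices: the sign of the permutation, or `0` if a vertex is
repeated. -/
def permSign (f : Fin 4 → Fin 4) : ℤ :=
  if h : Function.Bijective f then (Equiv.Perm.sign (Equiv.ofBijective f h) : ℤ) else 0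

/-- A closed normal curve in the star of the zero-cell `x`, given by the sequence of the simplices
it passes through. At each step it runs in `simplex t` near the vertex `apex t`, which is a copy of
`x`; it enters through the face opposite to the vertex `entry t` and leaves through the face opposite
to `exit t`, both containing `apex t`. Steps are counted cyclically (`finRotate` is `t ↦ t + 1`). -/
structure NormalCurve (K : DecoratedComplex ι) (x : K.ZeroCell) where
  length : ℕ
  simplex : Fin length → ι
  apex : Fin length → Fin 4
  entry : Fin length → Fin 4
  exit : Fin length → Fin 4
  apex_mem : ∀ t, Quot.mk K.vertexRel (simplex t, apex t) = x
  entry_ne : ∀ t, entry t ≠ apex t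
  exit_ne : ∀ t, exit t ≠ apex t
  glue_exit : ∀ t, K.glue (simplex t, exit t) =
    (simplex (finRotate length t), entry (finRotate length t))
  glue_apex : ∀ t, ∃ m : Fin 3, apex t = (exit t).succAbove m ∧
    apex (finRotate length t) = (entry (finRotate length t)).succAbove m

/-- The total log-parameter along a normal curve. In each simplex the curve passes the edge from
`v = apex t` to the vertex `j` different from `v`, `a = entry t` and `b = exit t` (no edge is passed
if `a = b`). Viewed from `v`, the edge is passed counterclockwise for the orientation given by the
vertex ordering if `(v, j, a, b)` is an even permutation and clockwise if it is odd; for the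
orientation of `K` this is multiplied by the sign of the simplex. The log-parameter of the edge is
counted with the sign of the simplex, and with `+` or `-` according to whether the edge is passed
counterclockwise or clockwise for the orientation of `K`. -/
def totalLogParam (K : DecoratedComplex ι) (w : ι → Fin 3 → ℂ) {x : K.ZeroCell}
    (γ : K.NormalCurve x) : ℂ :=
  ∑ t, ∑ j : Fin 4,
    ((K.sign (γ.simplex t) : ℤˣ) : ℤ) *
      ((((K.sign (γ.simplex t) : ℤˣ) : ℤ) *
        permSign ![γ.apex t, j, γ.entry t, γ.exit t] : ℤ) : ℂ) *
      edgeParam (w (γ.simplex t)) (γ.apex t) j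

open Classical in
/-- The total log-parameter around a one-cell: the sum, over all edges of simplices that are
identified to it, of the log-parameters multiplied by the signs of the simplices. -/
def edgeLogParam [Fintype ι] (K : DecoratedComplex ι) (w : ι → Fin 3 → ℂ) (E : K.OneCell) : ℂ :=
  ∑ p : ι × SimplexEdge, if Quot.mk K.edgeRel p = E then
    ((K.sign p.1 : ℤˣ) : ℤ) * edgeParam (w p.1) p.2.1.1 p.2.1.2 else 0

/-- A weak flattening: a flattening of each ideal simplex such that the total log-parameter around
each edge is zero. -/
def IsWeakFlattening [Fintype ι] (L : LogBranch) (K : DecoratedComplex ι)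
    (w : ι → Fin 3 → ℂ) : Prop :=
  (∀ s, IsFlattening L (crossRatio (K.simplex s).vertex) (w s)) ∧
    ∀ E : K.OneCell, K.edgeLogParam w E = 0

/-- A semi-strong flattening: moreover the total log-parameter along every normal curve in the star
of each zero-cell is zero. -/
def IsSemiStrongFlattening [Fintype ι] (L : LogBranch) (K : DecoratedComplex ι)
    (w : ι → Fin 3 → ℂ) : Prop :=
  K.IsWeakFlattening L w ∧ ∀ (x : K.ZeroCell) (γ : K.NormalCurve x), K.totalLogParam w γ = 0

/-- The log-parameters with which `Ψ` endows the simplices of `K`. -/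
def inducedFlattening (L : LogBranch) (K : DecoratedComplex ι) : ι → Fin 3 → ℂ :=
  fun s => Psi L (K.simplex s).generator

end DecoratedComplex

end IdealFlattening

end

noncomputable section

namespace IdealFlattening

open OnePoint

/-! Everything rests on one observation: `c_{ij}²` is the squared determinant of the first columns
of any two matrices taking `H(∞)` to `H_i` and `H_j`. Such a column is determined up to sign by the
horosphere, so `Log c_{ij}` is a symmetric, `G`-invariant function of the two horospheres
(`longCSq_generator`, `horoLog_symm`, `horoLog_smul`). In particular it takes the same value on both
sides of a face pairing.

Flattening: the column of `H_i` is a nonzero multiple `r_i` of the homogeneous coordinates of `v_i`,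
so `c_{ij}² = (r_i r_j (v_i - v_j))²`. The factors `r_i` cancel in `w₀` and `w₁`, which gives
`exp(w₀)² = z²` and, by the Plücker relation, `exp(w₁)² = (1 - z)⁻²`. The squares leave a sign free,
whence multiples of `πi` rather than `2πi`; and `w₀ + w₁ + w₂ = 0` identically.

Edges: the log-parameter of an edge is a difference of two terms, each depending only on one of the
two faces containing the edge (`sum_edgeParam_logTriple`). Glued faces carry equal terms with
opposite signs, so the total vanishes.

Vertices: passing an edge contributes the term of the face of entry minus that of the face of exit
(`sum_permSign_edgeParam_logTriple`), and the sum telescopes around the closed curve. -/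

/-! ### The pairing of euclidean horospheres -/

/-- The determinant of the first columns of two matrices. -/
def colDet (A B : SL2) : ℂ := A 0 0 * B 1 0 - A 1 0 * B 0 0

theorem colDet_swap (A B : SL2) : colDet B A = -colDet A B := by
  unfold colDet; ring

theorem colDet_mul (M A B : SL2) : colDet (M * A) (M * B) = colDet A B := by
  have h := SL2_det M
  simp only [colDet, SL2_mul]
  linear_combination (A 0 0 * B 1 0 - A 1 0 * B 0 0) * h

theorem inv_mul_one_zero (A B : SL2) : (A⁻¹ * B) 1 0 = colDet A B := by
  rw [SL2_mul, Matrix.SpecialLinearGroup.SL2_inv_expl]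
  simp [colDet]
  ring

/-- The stabilizer of `H(∞)` consists of matrices with first column `±(1, 0)`. -/
theorem col_of_smul_HInf_eq {A : SL2} (h : A • HInf = HInf) :
    A 1 0 = 0 ∧ A 0 0 ^ 2 = 1 := by
  have h0 : A 1 0 = 0 := by
    have hb : A • (∞ : OnePoint ℂ) = ∞ := congrArg EuclideanHorosphere.base h
    rw [smul_infty] at hb
    by_contra hne
    rw [if_neg hne] at hb
    exact OnePoint.coe_ne_infty _ hb
  refine ⟨h0, ?_⟩
  have hdet := SL2_det A
  rw [h0, mul_zero, sub_zero] at hdet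
  have hc : (fun ψ : ℂ → HypSpace => fun z => A • ψ z) '' horoCharts 1 1 = horoCharts 1 1 :=
    congrArg EuclideanHorosphere.charts h
  rw [image_horoCharts, mul_one] at hc
  -- Preserving the translation class of charts forces `A` to act on the plane at height 1 as a
  -- translation, with no rotation.
  have hmem : (fun z => A • height1 (1 * z + 0)) ∈ horoCharts 1 1 := hc ▸ ⟨0, rfl⟩
  obtain ⟨b, hb⟩ := hmem
  have key : ∀ z, (A • height1 z).z = z + b := by
    intro z
    have := congrArg HypSpace.z (congrFun hb z)
    simpa [height1] using this
  have hd : A 1 1 ≠ 0 := right_ne_zero_of_mul_eq_one hdet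
  have hz : ∀ z, (A • height1 z).z = (A 0 0 * z + A 0 1) / A 1 1 := by
    intro z
    have hs : star (A 1 1) ≠ 0 := star_ne_zero.mpr hd
    rw [smul_z, actDen_cast, h0]
    simp only [height1, zero_mul, zero_add, star_zero, mul_zero, add_zero]
    rw [mul_div_mul_right _ _ hs]
  have e0 := (hz 0).symm.trans (key 0)
  have e1 := (hz 1).symm.trans (key 1)
  rw [div_eq_iff hd] at e0 e1
  -- Subtracting the values at 0 and 1 gives equal diagonal entries, whose product is 1.
  linear_combination A 0 0 * (e1 - e0) + hdet

/-- `B⁻¹A` stabilizes `H(∞)`, so it multiplies the first basis vector by `±1`. -/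
theorem col_of_smul_HInf_eq_smul {A B : SL2} (h : A • HInf = B • HInf) :
    ∃ r : ℂ, r ^ 2 = 1 ∧ ∀ i, A i 0 = r * B i 0 := by
  have h' : (B⁻¹ * A) • HInf = HInf := by rw [mul_smul, h, inv_smul_smul]
  obtain ⟨h0, h1⟩ := col_of_smul_HInf_eq h'
  refine ⟨_, h1, fun i => ?_⟩
  have : A i 0 = (B * (B⁻¹ * A)) i 0 := by rw [mul_inv_cancel_left]
  rw [this, SL2_mul, h0]
  ring

/-- A matrix taking `H(∞)` to a given euclidean horosphere. -/
def EuclideanHorosphere.mat (H : EuclideanHorosphere) : SL2 := (exists_smul_HInf H).choose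

theorem EuclideanHorosphere.mat_smul (H : EuclideanHorosphere) : H.mat • HInf = H :=
  (exists_smul_HInf H).choose_spec

/-- The square of the determinant of the first columns of matrices taking `H(∞)` to `H`
and to `H'`. -/
def horoPairing (H H' : EuclideanHorosphere) : ℂ := colDet H.mat H'.mat ^ 2

/-- Other representatives change the columns only by signs, which the square removes. Hence the
arbitrary choices in `mat` and in the labeling behind `generator` do not matter. -/
theorem horoPairing_eq {A B : SL2} {H H' : EuclideanHorosphere} (hA : A • HInf = H)
    (hB : B • HInf = H') : horoPairing H H' = colDet A B ^ 2 := by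
  obtain ⟨r, hr, h⟩ := col_of_smul_HInf_eq_smul (H.mat_smul.trans hA.symm)
  obtain ⟨r', hr', h'⟩ := col_of_smul_HInf_eq_smul (H'.mat_smul.trans hB.symm)
  simp only [horoPairing, colDet, h, h']
  linear_combination (A 0 0 * B 1 0 - A 1 0 * B 0 0) ^ 2 * (r' ^ 2 * hr + hr')

theorem horoPairing_symm (H H' : EuclideanHorosphere) : horoPairing H H' = horoPairing H' H := by
  rw [horoPairing, horoPairing, colDet_swap, neg_sq]

theorem horoPairing_smul (A : SL2) (H H' : EuclideanHorosphere) :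
    horoPairing (A • H) (A • H') = horoPairing H H' := by
  rw [horoPairing_eq (A := A * H.mat) (B := A * H'.mat) (by rw [mul_smul, H.mat_smul])
    (by rw [mul_smul, H'.mat_smul]), colDet_mul, horoPairing]

/-- The lower left entry of `A⁻¹ * B` is the determinant of the first columns. The bridge from
labelings to pairs of horospheres. -/
theorem longCSq_generator {n : ℕ} (D : DecoratedSimplex n) (i j : Fin (n + 1)) (h : i ≠ j) :
    D.generator.longCSq i j h = horoPairing (D.horo i) (D.horo j) := by
  obtain ⟨A, hA, hAH⟩ := (exists_represents D).choose_spec i j h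
  obtain ⟨B, hB, hBH⟩ := (exists_represents D).choose_spec j i h.symm
  change cSq (((exists_represents D).choose.label i j h)⁻¹ *
    (exists_represents D).choose.label j i h.symm) = _
  rw [← hA, ← hB, ← map_inv, ← map_mul, horoPairing_eq hAH hBH, ← inv_mul_one_zero]
  rfl

/-- The first column of a matrix is a homogeneous coordinate vector of the image of `∞`; this links
the `c_{ij}` with differences of ideal vertices. -/
theorem EuclideanHorosphere.exists_col_eq (H : EuclideanHorosphere) :
    ∃ r : ℂ, r ≠ 0 ∧ H.mat 0 0 = r * (homog H.base).1 ∧ H.mat 1 0 = r * (homog H.base).2 := by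
  have hb : H.mat • (∞ : OnePoint ℂ) = H.base := congrArg EuclideanHorosphere.base H.mat_smul
  rw [← hb, smul_infty]
  have hdet := SL2_det H.mat
  split_ifs with h
  · exact ⟨H.mat 0 0, fun h' => by simp [h, h'] at hdet, by simp [homog], by simp [homog, h]⟩
  · exact ⟨H.mat 1 0, h, by simp [homog]; field_simp, by simp [homog]⟩

theorem hdiff_ne_zero {v w : OnePoint ℂ} (h : v ≠ w) : hdiff v w ≠ 0 := by
  intro h0
  apply h
  induction v using OnePoint.rec <;> induction w using OnePoint.rec <;>
    simp_all [hdiff, homog, sub_eq_zero]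

/-! ### Logarithms of the entries `c_{ij}` -/

/-- The square root of the pairing of two euclidean horospheres given by a branch of the
logarithm. -/
def horoRoot (L : LogBranch) (H H' : EuclideanHorosphere) : ℂ :=
  Complex.exp (L (horoPairing H H') / 2)

/-- The logarithm of `horoRoot`. -/
def horoLog (L : LogBranch) (H H' : EuclideanHorosphere) : ℂ := L (horoRoot L H H')

theorem horoLog_symm (L : LogBranch) (H H' : EuclideanHorosphere) :
    horoLog L H H' = horoLog L H' H := by
  rw [horoLog, horoRoot, horoPairing_symm]; rfl

theorem horoLog_smul (L : LogBranch) (A : SL2) (H H' : EuclideanHorosphere) :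
    horoLog L (A • H) (A • H') = horoLog L H H' := by
  rw [horoLog, horoRoot, horoPairing_smul]; rfl

theorem exp_horoLog (L : LogBranch) (H H' : EuclideanHorosphere) :
    Complex.exp (horoLog L H H') = horoRoot L H H' :=
  L.exp_toFun _ (Complex.exp_ne_zero _)

theorem horoRoot_sq (L : LogBranch) {H H' : EuclideanHorosphere} (h : horoPairing H H' ≠ 0) :
    horoRoot L H H' ^ 2 = horoPairing H H' := by
  rw [horoRoot, ← Complex.exp_nat_mul, Nat.cast_ofNat, mul_div_cancel₀ _ two_ne_zero,
    L.exp_toFun _ h]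

/-- The triple of log-parameters of a function on pairs of vertices. -/
def logTriple (l : Fin 4 → Fin 4 → ℂ) : Fin 3 → ℂ :=
  ![l 0 3 + l 1 2 - l 0 2 - l 1 3, l 0 2 + l 1 3 - l 0 1 - l 2 3,
    l 0 1 + l 2 3 - l 0 3 - l 1 2]

/-- `Log c_{ij}` for the decorated simplex `D`. -/
def DecoratedSimplex.edgeLog {n : ℕ} (D : DecoratedSimplex n) (L : LogBranch)
    (i j : Fin (n + 1)) : ℂ := horoLog L (D.horo i) (D.horo j)

theorem DecoratedSimplex.edgeLog_symm {n : ℕ} (D : DecoratedSimplex n) (L : LogBranch)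
    (i j : Fin (n + 1)) : D.edgeLog L i j = D.edgeLog L j i := horoLog_symm _ _ _

theorem DecoratedSimplex.Congruent.edgeLog_eq {n : ℕ} {D E : DecoratedSimplex n}
    (h : D.Congruent E) (L : LogBranch) (i j : Fin (n + 1)) :
    E.edgeLog L i j = D.edgeLog L i j := by
  obtain ⟨A, hA⟩ := h
  rw [edgeLog, hA, hA, horoLog_smul, edgeLog]

theorem Psi_generator (L : LogBranch) (D : DecoratedSimplex 3) :
    Psi L D.generator = logTriple (D.edgeLog L) := by
  simp only [Psi, BGen.longC, longCSq_generator]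
  rfl

/-! ### The flattening condition for one simplex -/

/-- Since `2w` and `2 L z` have the same exponential, they differ by a multiple of `2πi`. Continuity
of the branch plays no role. -/
theorem exists_eq_log_add_of_exp_sq_eq (L : LogBranch) {w z : ℂ} (hz : z ≠ 0)
    (h : Complex.exp w ^ 2 = z ^ 2) : ∃ p : ℤ, w = L z + p * (Real.pi * Complex.I) := by
  have h2 : Complex.exp (2 * w) = Complex.exp (2 * L z) := by
    rw [two_mul, two_mul, Complex.exp_add, Complex.exp_add, L.exp_toFun z hz, ← sq, ← sq, h]
  obtain ⟨n, hn⟩ := Complex.exp_eq_exp_iff_exists_int.mp h2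
  exact ⟨n, by linear_combination hn / 2⟩

theorem isFlattening_of_exp_sq (L : LogBranch) {z : ℂ} {w : Fin 3 → ℂ} (hz : z ≠ 0)
    (hz1 : 1 - z ≠ 0) (h0 : Complex.exp (w 0) ^ 2 = z ^ 2)
    (h1 : Complex.exp (w 1) ^ 2 * (1 - z) ^ 2 = 1) (hw : w 0 + w 1 + w 2 = 0) :
    IsFlattening L z w := by
  obtain ⟨p, hp⟩ := exists_eq_log_add_of_exp_sq_eq L hz h0
  have h1' : Complex.exp (-w 1) ^ 2 = (1 - z) ^ 2 := by
    rw [Complex.exp_neg, inv_pow, inv_eq_of_mul_eq_one_right h1]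
  obtain ⟨q, hq⟩ := exists_eq_log_add_of_exp_sq_eq L hz1 h1'
  -- `q` was obtained for `-w 1`, hence the sign; the third equation follows from the vanishing sum.
  refine ⟨p, -q, hp, ?_, ?_⟩
  · push_cast
    linear_combination -hq
  · push_cast
    linear_combination hw - hp + hq

theorem isFlattening_Psi (L : LogBranch) (D : DecoratedSimplex 3) :
    IsFlattening L (crossRatio D.vertex) (Psi L D.generator) := by
  choose r hr h0 h1 using fun i => (D.horo i).exists_col_eq
  have hd : ∀ i j, i ≠ j → hdiff (D.vertex i) (D.vertex j) ≠ 0 := fun i j h =>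
    hdiff_ne_zero (D.distinct.ne h)
  -- Each scale `r i` occurs equally often in numerator and denominator of the cross-ratio
  -- expressions below, so it will cancel.
  have hpair : ∀ i j, horoPairing (D.horo i) (D.horo j) =
      (r i * r j * hdiff (D.vertex i) (D.vertex j)) ^ 2 := by
    intro i j
    simp only [horoPairing, colDet, h0, h1, hdiff, DecoratedSimplex.vertex]
    ring
  have hexp : ∀ i j, i ≠ j → Complex.exp (D.edgeLog L i j) ^ 2 =
      (r i * r j * hdiff (D.vertex i) (D.vertex j)) ^ 2 := by
    intro i j h
    rw [DecoratedSimplex.edgeLog, exp_horoLog, horoRoot_sq, hpair]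
    rw [hpair]
    exact pow_ne_zero _ (mul_ne_zero (mul_ne_zero (hr i) (hr j)) (hd i j h))
  -- The Plücker relation among the six 2×2 minors of the homogeneous coordinates.
  have hz1 : 1 - crossRatio D.vertex =
      hdiff (D.vertex 0) (D.vertex 1) * hdiff (D.vertex 2) (D.vertex 3) /
        (hdiff (D.vertex 0) (D.vertex 2) * hdiff (D.vertex 1) (D.vertex 3)) := by
    rw [crossRatio, eq_div_iff (mul_ne_zero (hd 0 2 (by decide)) (hd 1 3 (by decide))), sub_mul,
      div_mul_cancel₀ _ (mul_ne_zero (hd 0 2 (by decide)) (hd 1 3 (by decide)))]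
    simp only [hdiff]
    ring
  have r0 := hr 0
  have r1 := hr 1
  have r2 := hr 2
  have r3 := hr 3
  have d01 := hd 0 1 (by decide)
  have d02 := hd 0 2 (by decide)
  have d03 := hd 0 3 (by decide)
  have d12 := hd 1 2 (by decide)
  have d13 := hd 1 3 (by decide)
  have d23 := hd 2 3 (by decide)
  rw [Psi_generator]
  apply isFlattening_of_exp_sq
  · exact div_ne_zero (mul_ne_zero d03 d12) (mul_ne_zero d02 d13)
  · rw [hz1]
    exact div_ne_zero (mul_ne_zero d01 d23) (mul_ne_zero d02 d13)
  · simp only [logTriple, Matrix.cons_val_zero, Complex.exp_sub, Complex.exp_add, div_pow, mul_pow,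
      crossRatio]
    rw [hexp 0 3 (by decide), hexp 1 2 (by decide), hexp 0 2 (by decide), hexp 1 3 (by decide)]
    field_simp
  · rw [hz1]
    simp only [logTriple, Matrix.cons_val_one, Matrix.cons_val_zero, Complex.exp_sub,
      Complex.exp_add, div_pow, mul_pow]
    rw [hexp 0 2 (by decide), hexp 1 3 (by decide), hexp 0 1 (by decide), hexp 2 3 (by decide)]
    field_simp
  · simp only [logTriple, Matrix.cons_val_one, Matrix.cons_val_zero, Matrix.cons_val]
    ring

/-! ### The edge and vertex conditions -/

/-- The index of the log-parameter attached to the edge joining two vertices. -/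
def edgeIndex : Fin 4 → Fin 4 → Fin 3 :=
  ![![2, 0, 2, 1], ![0, 2, 1, 2], ![2, 1, 2, 0], ![1, 2, 0, 2]]

/-- A lookup table suited to case analysis. The diagonal entries 2 match the default branch of
`edgeParam`. -/
theorem edgeParam_eq (w : Fin 3 → ℂ) (i j : Fin 4) : edgeParam w i j = w (edgeIndex i j) := by
  have h : edgeIndex i j =
      if ({i, j} : Finset (Fin 4)) = {0, 1} ∨ ({i, j} : Finset (Fin 4)) = {2, 3} then 0
      else if ({i, j} : Finset (Fin 4)) = {1, 2} ∨ ({i, j} : Finset (Fin 4)) = {0, 3} then 1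
      else 2 := by
    revert i j
    decide
  rw [h, edgeParam]
  split_ifs <;> rfl

/-- The signed contribution of a face of a simplex to the log-parameter of the `e`-th edge of
the face, the one opposite to its `e`-th vertex. -/
def faceEdgeTerm (l : Fin 3 → Fin 3 → ℂ) : Fin 3 → ℂ :=
  ![l 0 1 - l 0 2, l 1 2 - l 0 1, l 0 2 - l 1 2]

/-- The contribution of a face of a simplex to the log-parameter along a normal curve crossing
the face near its vertex `m`. -/
def faceVertexTerm (l : Fin 3 → Fin 3 → ℂ) : Fin 3 → ℂ :=
  ![l 0 1 + l 0 2 - l 1 2, l 0 1 + l 1 2 - l 0 2, l 0 2 + l 1 2 - l 0 1]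

/-- The edge of the face opposite to `k` that is opposite to the `e`-th vertex of the face. -/
def faceEdge (k : Fin 4) (e : Fin 3) : DecoratedComplex.SimplexEdge :=
  ⟨(k.succAbove (![1, 0, 0] e), k.succAbove (![2, 2, 1] e)), by
    revert k e; decide⟩

theorem sum_simplexEdge (g : DecoratedComplex.SimplexEdge → ℂ) :
    ∑ e, g e = g ⟨(0, 1), by decide⟩ + g ⟨(0, 2), by decide⟩ + g ⟨(0, 3), by decide⟩ +
      g ⟨(1, 2), by decide⟩ + g ⟨(1, 3), by decide⟩ + g ⟨(2, 3), by decide⟩ := by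
  have h : (Finset.univ : Finset DecoratedComplex.SimplexEdge) =
      {⟨(0, 1), by decide⟩, ⟨(0, 2), by decide⟩, ⟨(0, 3), by decide⟩, ⟨(1, 2), by decide⟩,
        ⟨(1, 3), by decide⟩, ⟨(2, 3), by decide⟩} := by decide
  rw [h]
  repeat rw [Finset.sum_insert (by decide)]
  rw [Finset.sum_singleton]
  ring

/-- Each edge lies in two faces, and its log-parameter splits accordingly: for the edge `01`, `w₀ =
(l 0 3 - l 1 3) - (l 0 2 - l 1 2)`, one bracket per face. The sign `(-1)^k` is the one in the
orientation condition on face pairings. An arbitrary weight `g` allows restriction to a single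
one-cell. -/
theorem sum_edgeParam_logTriple (l : Fin 4 → Fin 4 → ℂ) (g : DecoratedComplex.SimplexEdge → ℂ) :
    ∑ e, g e * edgeParam (logTriple l) e.1.1 e.1.2 =
      ∑ k : Fin 4, ∑ e : Fin 3, g (faceEdge k e) *
        ((-1) ^ (k : ℕ) * faceEdgeTerm (fun m m' => l (k.succAbove m) (k.succAbove m')) e) := by
  rw [sum_simplexEdge]
  have f00 : faceEdge 0 0 = ⟨(2, 3), by decide⟩ := by decide
  have f01 : faceEdge 0 1 = ⟨(1, 3), by decide⟩ := by decide
  have f02 : faceEdge 0 2 = ⟨(1, 2), by decide⟩ := by decide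
  have f10 : faceEdge 1 0 = ⟨(2, 3), by decide⟩ := by decide
  have f11 : faceEdge 1 1 = ⟨(0, 3), by decide⟩ := by decide
  have f12 : faceEdge 1 2 = ⟨(0, 2), by decide⟩ := by decide
  have f20 : faceEdge 2 0 = ⟨(1, 3), by decide⟩ := by decide
  have f21 : faceEdge 2 1 = ⟨(0, 3), by decide⟩ := by decide
  have f22 : faceEdge 2 2 = ⟨(0, 1), by decide⟩ := by decide
  have f30 : faceEdge 3 0 = ⟨(1, 2), by decide⟩ := by decide
  have f31 : faceEdge 3 1 = ⟨(0, 2), by decide⟩ := by decide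
  have f32 : faceEdge 3 2 = ⟨(0, 1), by decide⟩ := by decide
  have s00 : Fin.succAbove (0 : Fin 4) 0 = 1 := by decide
  have s01 : Fin.succAbove (0 : Fin 4) 1 = 2 := by decide
  have s02 : Fin.succAbove (0 : Fin 4) 2 = 3 := by decide
  have s10 : Fin.succAbove (1 : Fin 4) 0 = 0 := by decide
  have s11 : Fin.succAbove (1 : Fin 4) 1 = 2 := by decide
  have s12 : Fin.succAbove (1 : Fin 4) 2 = 3 := by decide
  have s20 : Fin.succAbove (2 : Fin 4) 0 = 0 := by decide
  have s21 : Fin.succAbove (2 : Fin 4) 1 = 1 := by decide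
  have s22 : Fin.succAbove (2 : Fin 4) 2 = 3 := by decide
  have s30 : Fin.succAbove (3 : Fin 4) 0 = 0 := by decide
  have s31 : Fin.succAbove (3 : Fin 4) 1 = 1 := by decide
  have s32 : Fin.succAbove (3 : Fin 4) 2 = 2 := by decide
  simp only [edgeParam_eq, edgeIndex, Fin.sum_univ_four, Fin.sum_univ_three, f00, f01, f02, f10, f11, f12, f20, f21, f22,
    f30, f31, f32, faceEdgeTerm, logTriple, Matrix.cons_val_zero, Matrix.cons_val_one,
    Matrix.cons_val, s00, s01, s02, s10, s11, s12, s20, s21, s22, s30, s31, s32]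
  simp only [Fin.val_zero, Fin.val_one, Fin.val_two, show ((3 : Fin 4) : ℕ) = 3 from rfl]
  ring

/-! ### Signs of vertex sequences and telescoping at a vertex. -/

/-- The sign of the difference of two vertices, which is `0` if they are equal. -/
def orderSign (i j : Fin 4) : ℤ := if i < j then 1 else if j < i then -1 else 0

/-- The inversion formula for the sign; a repeated vertex makes a factor vanish. In this form all
cases can be evaluated. -/
theorem permSign_eq_prod (v j a b : Fin 4) : DecoratedComplex.permSign ![v, j, a, b] =
    orderSign v j * orderSign v a * orderSign v b * orderSign j a * orderSign j b *
      orderSign a b := by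
  unfold DecoratedComplex.permSign
  split_ifs with h
  · have hs : ∀ x y : Fin 4, x ≠ y → ((if x < y then 1 else -1 : ℤˣ) : ℤ) = orderSign x y := by
      decide
    have hinj : ∀ x y : Fin 4, x ≠ y → ![v, j, a, b] x ≠ ![v, j, a, b] y := fun _ _ => h.1.ne
    rw [Equiv.Perm.sign_eq_prod_prod_Ioi]
    have i0 : Finset.Ioi (0 : Fin 4) = {1, 2, 3} := by decide
    have i1 : Finset.Ioi (1 : Fin 4) = {2, 3} := by decide
    have i2 : Finset.Ioi (2 : Fin 4) = {3} := by decide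
    have i3 : Finset.Ioi (3 : Fin 4) = ∅ := by decide
    rw [Fin.prod_univ_four, i0, i1, i2, i3, Finset.prod_insert (by decide),
      Finset.prod_pair (by decide), Finset.prod_pair (by decide), Finset.prod_singleton,
      Finset.prod_empty]
    simp only [Units.val_mul, Equiv.ofBijective_apply, Units.val_one]
    rw [hs _ _ (hinj 0 1 (by decide)), hs _ _ (hinj 0 2 (by decide)), hs _ _ (hinj 0 3 (by decide)),
      hs _ _ (hinj 1 2 (by decide)), hs _ _ (hinj 1 3 (by decide)), hs _ _ (hinj 2 3 (by decide))]
    simp only [Matrix.cons_val_zero, Matrix.cons_val_one, Matrix.cons_val]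
    ring
  · rw [← Finite.injective_iff_bijective] at h
    by_contra hne
    have hs : ∀ x : Fin 4, orderSign x x = 0 := by decide
    apply h
    have : v ≠ j ∧ v ≠ a ∧ v ≠ b ∧ j ≠ a ∧ j ≠ b ∧ a ≠ b := by
      refine ⟨?_, ?_, ?_, ?_, ?_, ?_⟩ <;> rintro rfl <;> simp [hs] at hne
    intro x y hxy
    fin_cases x <;> fin_cases y <;> simp_all

/-- Swapping `a` and `b` reverses the sign of the bracket on the right, so the bracket already
contains the sign of the passage. The factor `permSign ^ 2` only discards sequences with a
repetition. -/
theorem permSign_mul_edgeParam_logTriple (l : Fin 4 → Fin 4 → ℂ) (hl : ∀ i j, l i j = l j i)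
    (v j a b : Fin 4) :
    (DecoratedComplex.permSign ![v, j, a, b] : ℂ) * edgeParam (logTriple l) v j =
      (DecoratedComplex.permSign ![v, j, a, b] : ℂ) ^ 2 * (l v b + l j a - l v a - l j b) := by
  have h10 := hl 1 0
  have h20 := hl 2 0
  have h30 := hl 3 0
  have h21 := hl 2 1
  have h31 := hl 3 1
  have h32 := hl 3 2
  rw [permSign_eq_prod, edgeParam_eq]
  fin_cases v <;> fin_cases j <;> fin_cases a <;> fin_cases b <;>
    first
    | (simp [orderSign]; done)
    | (simp [orderSign, edgeIndex, logTriple, h10, h20, h30, h21, h31, h32]; try ring)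

theorem permSign_sq (v j a b : Fin 4) : DecoratedComplex.permSign ![v, j, a, b] ^ 2 =
    if v ≠ j ∧ v ≠ a ∧ v ≠ b ∧ j ≠ a ∧ j ≠ b ∧ a ≠ b then 1 else 0 := by
  rw [permSign_eq_prod]
  decide +revert

/-- At most one `j` contributes. For `v` the common vertex, adding and subtracting `l v j` turns the
bracket into `(l v b + l v j - l j b) - (l v a + l v j - l j a)`, the terms of the faces opposite to
`a` and `b`. If `a = b` no edge is passed, and `h` forces `m = n`, so both sides are 0. -/
theorem sum_permSign_edgeParam_logTriple (l : Fin 4 → Fin 4 → ℂ) (hl : ∀ i j, l i j = l j i)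
    (a b : Fin 4) (m n : Fin 3) (h : a.succAbove m = b.succAbove n) :
    ∑ j : Fin 4, (DecoratedComplex.permSign ![a.succAbove m, j, a, b] : ℂ) *
        edgeParam (logTriple l) (a.succAbove m) j =
      faceVertexTerm (fun i j => l (a.succAbove i) (a.succAbove j)) m -
        faceVertexTerm (fun i j => l (b.succAbove i) (b.succAbove j)) n := by
  have hsq : ∀ v j a b : Fin 4, (DecoratedComplex.permSign ![v, j, a, b] : ℂ) ^ 2 =
      if v ≠ j ∧ v ≠ a ∧ v ≠ b ∧ j ≠ a ∧ j ≠ b ∧ a ≠ b then 1 else 0 := fun v j a b => by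
    exact_mod_cast congrArg (Int.cast : ℤ → ℂ) (permSign_sq v j a b)
  simp only [permSign_mul_edgeParam_logTriple l hl, hsq]
  have h10 := hl 1 0
  have h20 := hl 2 0
  have h30 := hl 3 0
  have h21 := hl 2 1
  have h31 := hl 3 1
  have h32 := hl 3 2
  clear hsq
  fin_cases a <;> fin_cases b <;> fin_cases m <;> fin_cases n <;>
    first
    | exact absurd h (by decide)
    | (simp [faceVertexTerm, Fin.sum_univ_four, Fin.succAbove, Fin.lt_def, h10, h20, h30, h21, h31, h32]; try ring)
-- Cancellation across the face pairings of a complex.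
namespace DecoratedComplex

variable {ι : Type*}

/-- `Log c_{ij}` on a face of a simplex of `K`. -/
def faceLog (K : DecoratedComplex ι) (L : LogBranch) (f : ι × Fin 4) (m m' : Fin 3) : ℂ :=
  (K.simplex f.1).edgeLog L (f.2.succAbove m) (f.2.succAbove m')

theorem faceLog_glue (K : DecoratedComplex ι) (L : LogBranch) (f : ι × Fin 4) :
    K.faceLog L (K.glue f) = K.faceLog L f := by
  funext m m'
  exact (K.congruent f).edgeLog_eq L m m'

theorem inducedFlattening_eq (K : DecoratedComplex ι) (L : LogBranch) (s : ι) :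
    K.inducedFlattening L s = logTriple ((K.simplex s).edgeLog L) := Psi_generator _ _

theorem mk_faceEdge_glue (K : DecoratedComplex ι) (f : ι × Fin 4) (e : Fin 3) :
    Quot.mk K.edgeRel ((K.glue f).1, faceEdge (K.glue f).2 e) =
      Quot.mk K.edgeRel (f.1, faceEdge f.2 e) :=
  (Quot.sound ⟨f, _, _, rfl, rfl, rfl, rfl⟩).symm

open Classical in
theorem edgeLogParam_inducedFlattening [Fintype ι] (K : DecoratedComplex ι) (L : LogBranch)
    (E : K.OneCell) : K.edgeLogParam (K.inducedFlattening L) E = 0 := by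
  -- The contribution of the face `f` to the total around `E`.
  let T : ι × Fin 4 → ℂ := fun f => ∑ e : Fin 3,
    (if Quot.mk K.edgeRel (f.1, faceEdge f.2 e) = E then ((K.sign f.1 : ℤ) : ℂ) else 0) *
      ((-1) ^ (f.2 : ℕ) * faceEdgeTerm (K.faceLog L f) e)
  have hsum : K.edgeLogParam (K.inducedFlattening L) E = ∑ f, T f := by
    rw [edgeLogParam, Fintype.sum_prod_type, Fintype.sum_prod_type]
    refine Finset.sum_congr rfl fun s _ => ?_
    have := sum_edgeParam_logTriple ((K.simplex s).edgeLog L)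
      (fun e => if Quot.mk K.edgeRel (s, e) = E then ((K.sign s : ℤ) : ℂ) else 0)
    rw [← K.inducedFlattening_eq] at this
    simp only [T, ite_mul, zero_mul] at this ⊢
    exact this
  -- Glued faces have the same edge classes and logarithms, but opposite induced orientations.
  have hT : ∀ f, T (K.glue f) = -T f := by
    intro f
    have ho : ((K.sign (K.glue f).1 : ℤ) : ℂ) * (-1) ^ ((K.glue f).2 : ℕ) =
        -(((K.sign f.1 : ℤ) : ℂ) * (-1) ^ (f.2 : ℕ)) := by
      have := congrArg (fun u : ℤˣ => ((u : ℤ) : ℂ)) (K.oriented f)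
      simpa using this
    simp only [T, ← Finset.sum_neg_distrib]
    refine Finset.sum_congr rfl fun e _ => ?_
    rw [mk_faceEdge_glue, faceLog_glue]
    split_ifs
    · linear_combination faceEdgeTerm (K.faceLog L f) e * ho
    · simp
  -- Reindexing by the involution shows that the sum equals its own negative.
  have hglue : ∑ f, T (K.glue f) = ∑ f, T f :=
    Equiv.sum_comp (Function.Involutive.toPerm K.glue K.glue_glue) T
  simp only [hT, Finset.sum_neg_distrib] at hglue
  rw [hsum]
  linear_combination -hglue / 2

theorem totalLogParam_inducedFlattening (K : DecoratedComplex ι) (L : LogBranch)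
    {x : K.ZeroCell} (γ : K.NormalCurve x) :
    K.totalLogParam (K.inducedFlattening L) γ = 0 := by
  choose m hm hm' using γ.glue_apex
  let ρ := finRotate γ.length
  -- The term of the face through which the curve leaves at step `t`.
  let X : Fin γ.length → ℂ := fun t =>
    faceVertexTerm (K.faceLog L (γ.simplex t, γ.exit t)) (m t)
  have hstep : ∀ t, ∑ j : Fin 4, ((K.sign (γ.simplex (ρ t)) : ℤˣ) : ℤ) *
      ((((K.sign (γ.simplex (ρ t)) : ℤˣ) : ℤ) *
        permSign ![γ.apex (ρ t), j, γ.entry (ρ t), γ.exit (ρ t)] : ℤ) : ℂ) *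
      edgeParam (K.inducedFlattening L (γ.simplex (ρ t))) (γ.apex (ρ t)) j = X t - X (ρ t) := by
    intro t
    -- The exit face at step `t` is glued to the entry face at step `ρ t`, with the apex at the same
    -- position `m t` in both.
    have hX : X t = faceVertexTerm (K.faceLog L (γ.simplex (ρ t), γ.entry (ρ t))) (m t) := by
      rw [← γ.glue_exit t, faceLog_glue]
    -- The sign of the simplex enters twice, as weight and as viewing orientation, and so drops out.
    have hs : ((K.sign (γ.simplex (ρ t)) : ℤ) : ℂ) * ((K.sign (γ.simplex (ρ t)) : ℤ) : ℂ) = 1 := by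
      rw [← Int.cast_mul, ← Units.val_mul, Int.units_mul_self]; simp
    have key := sum_permSign_edgeParam_logTriple ((K.simplex (γ.simplex (ρ t))).edgeLog L)
      (DecoratedSimplex.edgeLog_symm _ L) (γ.entry (ρ t)) (γ.exit (ρ t)) (m t) (m (ρ t))
      ((hm' t).symm.trans (hm (ρ t)))
    rw [← K.inducedFlattening_eq, ← hm' t] at key
    rw [hX]
    refine Eq.trans (Finset.sum_congr rfl fun j _ => ?_) key
    push_cast
    linear_combination (permSign ![γ.apex (ρ t), j, γ.entry (ρ t), γ.exit (ρ t)] : ℂ) *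
      edgeParam (K.inducedFlattening L (γ.simplex (ρ t))) (γ.apex (ρ t)) j * hs
  rw [totalLogParam, ← Equiv.sum_comp ρ, Finset.sum_congr rfl fun t _ => hstep t,
    Finset.sum_sub_distrib, Equiv.sum_comp ρ X, sub_self]

end DecoratedComplex

end IdealFlattening

end

theorem mainTheorem9 (L : IdealFlattening.LogBranch) {ι : Type*} [Fintype ι]
    (K : IdealFlattening.DecoratedComplex ι) (c : IdealFlattening.H3) (hK : K.RepresentsClass c) :
    K.IsSemiStrongFlattening L (K.inducedFlattening L) :=
  ⟨⟨fun s => IdealFlattening.isFlattening_Psi L (K.simplex s),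
    fun E => K.edgeLogParam_inducedFlattening L E⟩,
    fun _ γ => K.totalLogParam_inducedFlattening L γ⟩
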